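/- Consider $N\ge 1$ point vortices $z_i=(x_i,y_i)\in\mathbb{R}^2$ with vorticities $\Gamma_i$, moving according to $$\Gamma_i\,\dot z_i=\mathbb{J}\,\nabla_{z_i}H(\mathbf z)\quad(1\le i\le N),\qquad H(\mathbf z)=-\frac1{4\pi}\sum_{1\le i<j\le N}\Gamma_i\Gamma_j\log|z_i-z_j|^2,\qquad \mathbb{J}=\begin{pmatrix}0&1\\-1&0\end{pmatrix},$$ where $\mathbf z=(z_1,\dots,z_N)$ and $z_i\neq z_j$ for $i\ne j$. When $\sum_i\Gamma_i\neq 0$, a relative equilibrium is a periodic solution of the form $z_i(t)=e^{\mathbb{J}\omega t}(z_i(0)-a)+a$ for some $\omega\in\mathbb{R}$, where $a=\sum_i\Gamma_iz_i(0)\big/\sum_i\Gamma_i$ is the centre of vorticity. It is called normalised if $\sum_i\Gamma_i z_i(t)=0$ and $\sum_i\Gamma_i|z_i(t)|^2=1$ for all $t$. Let $\mathcal H_1\subset\mathbb{R}$ be the set of all values $H(\mathbf z)$ taken along normalised relative equilibria $\mathbf z$ (note that $H$ is constant along solutions). If there is $c\in\mathbb{R}\setminus\{0\}$ with $\Gamma_i=c$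 for all $1\le i\le N$, then $\mathcal H_1$ is a finite set. -/

import Mathlib

namespace NVortex

noncomputable section

/-- Positions `z = (z₁, …, z_N)` of `N` point vortices; the plane `ℝ²` is identified with `ℂ`
through `(x, y) ↦ x + i y`. -/
abbrev Config (N : ℕ) : Type := Fin N → ℂ

/-- The Hamiltonian `H(z) = -(1/4π) ∑_{i<j} Γ_i Γ_j log |z_i - z_j|²`. -/
def hamiltonian {N : ℕ} (Γ : Fin N → ℝ) (z : Config N) : ℝ :=
  -(1 / (4 * Real.pi)) *
    ∑ i : Fin N, ∑ j ∈ Finset.Ioi i, Γ i * Γ j * Real.log (‖z i - z j‖ ^ 2)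

/-- The gradient `∇_{z_i} H = ∂H/∂x_i + i ∂H/∂y_i` of `H` in the position of the `i`-th vortex
(for the real inner product of `ℂ = ℝ²`). -/
def gradH {N : ℕ} (Γ : Fin N → ℝ) (z : Config N) (i : Fin N) : ℂ :=
  gradient (fun w : ℂ => hamiltonian Γ (Function.update z i w)) (z i)

/-- The matrix `𝕁 = [[0, 1], [-1, 0]]`, i.e. `(x, y) ↦ (y, -x)`. -/
def symJ (w : ℂ) : ℂ := ⟨w.im, -w.re⟩

/-- The matrix exponential `exp (θ 𝕁) = cos θ + 𝕁 sin θ`, acting on the plane. -/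
def rotJ (θ : ℝ) (w : ℂ) : ℂ := Real.cos θ • w + Real.sin θ • symJ w

/-- `z : ℝ → ℂ^N` is an orbit, defined for all times and free of collisions, of the `N`-vortex
system `Γ_i ż_i = 𝕁 ∇_{z_i} H(z)`. -/
def IsOrbit {N : ℕ} (Γ : Fin N → ℝ) (z : ℝ → Config N) : Prop :=
  (∀ t, Function.Injective (z t)) ∧
    ∀ t i, ∃ v : ℂ, HasDerivAt (fun s => z s i) v t ∧ Γ i • v = symJ (gradH Γ (z t) i)

/-- The moment `P + i Q = ∑ Γ_i z_i`, where `P = ∑ Γ_i x_i` and `Q = ∑ Γ_i y_i`. -/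
def moment {N : ℕ} (Γ : Fin N → ℝ) (z : Config N) : ℂ := ∑ i, Γ i • z i

/-- The quantity `I(z) = ∑ Γ_i |z_i|²`. -/
def angularImpulse {N : ℕ} (Γ : Fin N → ℝ) (z : Config N) : ℝ := ∑ i, Γ i * ‖z i‖ ^ 2

/-- The centre of vorticity `c = (∑ Γ_i z_i) / (∑ Γ_i)`. -/
def vorticityCentre {N : ℕ} (Γ : Fin N → ℝ) (z : Config N) : ℂ :=
  (∑ i, Γ i)⁻¹ • moment Γ z

/-- Centred: `P = Q = 0` along `z`. -/
def IsCentred {N : ℕ} (Γ : Fin N → ℝ) (z : ℝ → Config N) : Prop :=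
  ∀ t, moment Γ (z t) = 0

/-- Normalised: centred, and `I = 1` along `z`. -/
def IsNormalised {N : ℕ} (Γ : Fin N → ℝ) (z : ℝ → Config N) : Prop :=
  IsCentred Γ z ∧ ∀ t, angularImpulse Γ (z t) = 1

/-- A relative equilibrium: a periodic orbit (with `∑ Γ_i ≠ 0`) of the form
`z_i(t) = exp (ω t 𝕁) (z_i(0) - c) + c`, with `c` the centre of vorticity. -/
def IsRelativeEquilibrium {N : ℕ} (Γ : Fin N → ℝ) (z : ℝ → Config N) : Prop :=
  IsOrbit Γ z ∧ (∑ i, Γ i) ≠ 0 ∧ (∃ T : ℝ, 0 < T ∧ ∀ t, z (t + T) = z t) ∧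
    ∃ ω : ℝ, ∀ t i,
      z t i = rotJ (ω * t) (z 0 i - vorticityCentre Γ (z 0)) + vorticityCentre Γ (z 0)

/-- The set `𝒵₁(H)` of normalised relative equilibria. -/
def Z1 {N : ℕ} (Γ : Fin N → ℝ) : Set (ℝ → Config N) :=
  {z | IsRelativeEquilibrium Γ z ∧ IsNormalised Γ z}

/-- The set `ℋ₁` of energy levels of normalised relative equilibria: all values that `H` takes
along some normalised relative equilibrium. -/
def H1 {N : ℕ} (Γ : Fin N → ℝ) : Set ℝ :=
  {h | ∃ z ∈ Z1 Γ, ∃ t : ℝ, h = hamiltonian Γ (z t)}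

end

end NVortex

/-!
The energy levels are the critical values of a polynomial on a real algebraic set, and they are
found to be finite in number by an algebraic form of Sard's theorem.

For identical vortices of strength `c`, the positions of a normalised relative equilibrium satisfy
`μ z_i = ∑_{j ≠ i} 1 / conj (z_i - z_j)` with `μ` real, and `∑ |z_i|² = 1 / c`
(`exists_isCentralConfig`), while `H = -(c² / 4π) log P` with `P = ∏_{i<j} |z_i - z_j|²`
(`hamiltonian_const`). So it suffices that `P` takes finitely many values on such configurations.
Replace `conj z` by an independent variable `w`: the equations become the algebraic equations
`μ w_i = ∑ 1 / (z_i - z_j)`, `μ z_i = ∑ 1 / (w_i - w_j)`, `∑ z_i w_i = r` (`IsCentralConfig`), and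
`P` becomes `∏_{i<j} (z_i - z_j) (w_i - w_j)` (`pairProd`). In any field `K` containing `ℂ`, a
solution of these equations with `r ∈ ℂ` satisfies `dP / P = μ d(∑ z_i w_i) = μ dr = 0` in
`Ω[K⁄ℂ]`. In characteristic zero an element with vanishing differential is algebraic
(`isAlgebraic_of_kaehlerDifferential_D_eq_zero`), so `P ∈ ℂ`.

If `P` took infinitely many values on complex solutions, a sequence of solutions with distinct
values of `P` would define a solution in an ultrapower `K` of `ℂ` whose `P` is not in `ℂ`, which is
impossible (`finite_pairProd`).
-/

namespace NVortex

/-! ### Differentials in field extensions -/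

open Polynomial TensorProduct in
/-- In characteristic zero, an element of a field extension `K / k` whose differential vanishes is
algebraic. If `f` were transcendental, then `K` would be formally smooth over `k[X]` (acting
through `X ↦ f`), so that `K ⊗ Ω[k[X]⁄k] → Ω[K⁄k]` would be injective; it maps `1 ⊗ dX` to
`df`. -/
theorem isAlgebraic_of_kaehlerDifferential_D_eq_zero {k K : Type*} [Field k] [CharZero k] [Field K]
    [Algebra k K] {f : K} (hf : KaehlerDifferential.D k K f = 0) : IsAlgebraic k f := by
  by_contra htr
  have hinj : Function.Injective (aeval (R := k) f) := transcendental_iff_injective.1 htr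
  let : Algebra k[X] K := (aeval (R := k) f).toAlgebra
  have hX : algebraMap k[X] K X = f := aeval_X f
  have : IsScalarTower k k[X] K :=
    IsScalarTower.of_algebraMap_eq fun a => ((aeval (R := k) f).commutes a).symm
  have : FaithfulSMul k[X] K := (faithfulSMul_iff_algebraMap_injective _ _).2 hinj
  let F := FractionRing k[X]
  let : Algebra F K := FractionRing.liftAlgebra k[X] K
  have : IsScalarTower k[X] F K := FractionRing.isScalarTower_liftAlgebra k[X] K
  have : CharZero F := charZero_of_injective_algebraMap (R := k[X]) (IsFractionRing.injective _ _)
  have : Algebra.FormallySmooth F K := by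
    obtain ⟨s, hs⟩ := exists_isTranscendenceBasis F K
    have := hs.isAlgebraic_field
    exact .of_algebraicIndependent_of_isSeparable hs.1
  have : Algebra.FormallyEtale k[X] F := .of_isLocalization (nonZeroDivisors k[X])
  have : Algebra.FormallySmooth k[X] K := .comp k[X] F K
  have hinj' : Function.Injective (KaehlerDifferential.mapBaseChange k k[X] K) := by
    rw [injective_iff_map_eq_zero]
    intro x hx
    obtain ⟨y, rfl⟩ := (Algebra.H1Cotangent.exact_δ_mapBaseChange k k[X] K x).1 hx
    rw [Subsingleton.elim y 0, map_zero]
  have h0 : (1 : K) ⊗ₜ[k[X]] KaehlerDifferential.D k k[X] X = 0 := by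
    apply hinj'
    rw [KaehlerDifferential.mapBaseChange_tmul, KaehlerDifferential.map_D, hX, hf, smul_zero,
      map_zero]
  have h1 := congrArg (TensorProduct.rid k[X] K ∘
    (KaehlerDifferential.polynomialEquiv k).toLinearMap.lTensor K) h0
  simp at h1

/-- Leibniz' rule for the logarithmic derivative of a product. -/
theorem derivation_prod {k K M ι : Type*} [CommRing k] [Field K] [Algebra k K] [AddCommGroup M]
    [Module K M] [Module k M] (D : Derivation k K M) (s : Finset ι) (g : ι → K)
    (hg : ∀ i ∈ s, g i ≠ 0) :
    D (∏ i ∈ s, g i) = (∏ i ∈ s, g i) • ∑ i ∈ s, (g i)⁻¹ • D (g i) := by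
  classical
  induction s using Finset.induction_on with
  | empty => simp
  | insert a s ha ih =>
    have h1 := hg a (Finset.mem_insert_self a s)
    rw [Finset.prod_insert ha, Finset.sum_insert ha, D.leibniz,
      ih fun i hi => hg i (Finset.mem_insert_of_mem hi), smul_add, smul_smul, smul_smul,
      mul_right_comm, mul_inv_cancel₀ h1, one_mul, add_comm]

/-! ### Central configurations over a field -/

/-- The sum over unordered pairs of the terms `g i j • (a i - a j)`, with `g` antisymmetric,
collects to `g i j • a i` summed over ordered pairs. -/
theorem sum_Ioi_smul_sub {R M : Type*} [Ring R] [AddCommGroup M] [Module R M] {N : ℕ}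
    (g : Fin N → Fin N → R) (a : Fin N → M) (h0 : ∀ i, g i i = 0) (h : ∀ i j, g j i = -g i j) :
    ∑ i, ∑ j ∈ Finset.Ioi i, g i j • (a i - a j) = ∑ i, ∑ j, g i j • a i := by
  have h1 := Finset.sum_sum_Ioi_add_eq_sum_sum_off_diag fun i j => g j i • a j
  calc _ = _ := by
        refine Finset.sum_congr rfl fun i _ => Finset.sum_congr rfl fun j _ => ?_
        rw [smul_sub, sub_eq_add_neg, ← neg_smul, ← h i j]
    _ = _ := h1
    _ = _ := by
        refine Finset.sum_congr rfl fun i _ => ?_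
        refine Finset.sum_subset (Finset.subset_univ _) fun j _ hj => ?_
        obtain rfl : j = i := by simpa using hj
        rw [h0, zero_smul]

/-- The product `∏_{i<j} (z_i - z_j) (w_i - w_j)`: the complexification of
`∏_{i<j} |z_i - z_j|²`, in which the conjugate of `z` becomes an independent variable `w`. -/
def pairProd {K : Type*} [Field K] {N : ℕ} (z w : Fin N → K) : K :=
  ∏ i, ∏ j ∈ Finset.Ioi i, (z i - z j) * (w i - w j)

/-- The complexified equations of a relative equilibrium of identical vortices, with multiplier
`μ` and `∑ |z_i|² = r`; the conjugate of `z` becomes an independent variable `w`. Terms with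
`j = i` are `0⁻¹ = 0`. -/
structure IsCentralConfig {K : Type*} [Field K] {N : ℕ} (r μ : K) (z w : Fin N → K) : Prop where
  injective_left : Function.Injective z
  injective_right : Function.Injective w
  eq_left : ∀ i, μ * w i = ∑ j, (z i - z j)⁻¹
  eq_right : ∀ i, μ * z i = ∑ j, (w i - w j)⁻¹
  sum_mul : ∑ i, z i * w i = r

/-- A derivation that kills `∑ z_i w_i` kills the pair product: on central configurations,
`dP / P = μ d(∑ z_i w_i)`. -/
theorem IsCentralConfig.derivation_pairProd_eq_zero {k K M : Type*} [CommRing k] [Field K]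
    [Algebra k K] [AddCommGroup M] [Module K M] [Module k M] (D : Derivation k K M) {N : ℕ}
    {r μ : K} {z w : Fin N → K} (h : IsCentralConfig r μ z w) (hr : D r = 0) :
    D (pairProd z w) = 0 := by
  have hz : ∀ i, ∀ j ∈ Finset.Ioi i, z i - z j ≠ 0 := fun i j hj =>
    sub_ne_zero.2 (h.injective_left.ne (Finset.mem_Ioi.1 hj).ne)
  have hw : ∀ i, ∀ j ∈ Finset.Ioi i, w i - w j ≠ 0 := fun i j hj =>
    sub_ne_zero.2 (h.injective_right.ne (Finset.mem_Ioi.1 hj).ne)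
  have hzw : ∀ i, ∀ j ∈ Finset.Ioi i, (z i - z j) * (w i - w j) ≠ 0 := fun i j hj =>
    mul_ne_zero (hz i j hj) (hw i j hj)
  have hanti : ∀ (u : Fin N → K) i j, (u j - u i)⁻¹ = -(u i - u j)⁻¹ := fun u i j => by
    rw [← neg_sub, inv_neg]
  rw [pairProd, derivation_prod D _ _ fun i _ => Finset.prod_ne_zero_iff.2 (hzw i)]
  have key : ∑ i, (∏ j ∈ Finset.Ioi i, (z i - z j) * (w i - w j))⁻¹ •
      D (∏ j ∈ Finset.Ioi i, (z i - z j) * (w i - w j)) = μ • D r := by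
    calc _ = ∑ i, ∑ j ∈ Finset.Ioi i, (z i - z j)⁻¹ • (D (z i) - D (z j)) +
          ∑ i, ∑ j ∈ Finset.Ioi i, (w i - w j)⁻¹ • (D (w i) - D (w j)) := by
          rw [← Finset.sum_add_distrib]
          refine Finset.sum_congr rfl fun i _ => ?_
          rw [derivation_prod D _ _ (hzw i),
            inv_smul_smul₀ (Finset.prod_ne_zero_iff.2 (hzw i)), ← Finset.sum_add_distrib]
          refine Finset.sum_congr rfl fun j hj => ?_
          rw [D.leibniz, smul_add, smul_smul, smul_smul, mul_inv, mul_assoc _ _ (z i - z j),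
            mul_comm _ (z i - z j), inv_mul_cancel_left₀ (hz i j hj),
            inv_mul_cancel_right₀ (hw i j hj),
            map_sub, map_sub, add_comm]
      _ = ∑ i, (∑ j, (z i - z j)⁻¹) • D (z i) + ∑ i, (∑ j, (w i - w j)⁻¹) • D (w i) := by
          rw [sum_Ioi_smul_sub (fun i j => (z i - z j)⁻¹) (fun i => D (z i)) (by simp) (hanti z),
            sum_Ioi_smul_sub (fun i j => (w i - w j)⁻¹) (fun i => D (w i)) (by simp) (hanti w)]
          simp only [Finset.sum_smul]
      _ = _ := by
          rw [← h.sum_mul, map_sum, Finset.smul_sum, ← Finset.sum_add_distrib]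
          refine Finset.sum_congr rfl fun i _ => ?_
          rw [← h.eq_left, ← h.eq_right, D.leibniz, smul_add, smul_smul, smul_smul, add_comm]
  rw [key, hr, smul_zero, smul_zero]

/-- Over an algebraically closed field `k` of characteristic zero, the pair product of a central
configuration with coordinates in an extension of `k`, but `∑ z_i w_i` in `k`, lies in `k`. -/
theorem IsCentralConfig.exists_algebraMap_eq_pairProd {k K : Type*} [Field k] [CharZero k]
    [IsAlgClosed k] [Field K] [Algebra k K] {N : ℕ} {r : k} {μ : K} {z w : Fin N → K}
    (h : IsCentralConfig (algebraMap k K r) μ z w) : ∃ a, algebraMap k K a = pairProd z w :=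
  have halg := isAlgebraic_of_kaehlerDifferential_D_eq_zero
    (h.derivation_pairProd_eq_zero (KaehlerDifferential.D k K) (Derivation.map_algebraMap _ r))
  minpoly.mem_range_of_degree_eq_one k _
    (IsAlgClosed.degree_eq_one_of_irreducible k (minpoly.irreducible halg.isIntegral))

/-! ### Finiteness via an ultrapower -/

open Filter in
/-- The pair product takes finitely many values on complex central configurations with given
`∑ z_i w_i`. A sequence with distinct values would be, in the ultrapower of `ℂ`, one central
configuration whose pair product is not a constant. -/
theorem finite_pairProd (N : ℕ) (r : ℂ) :
    {p : ℂ | ∃ (μ : ℂ) (z w : Fin N → ℂ), IsCentralConfig r μ z w ∧ pairProd z w = p}.Finite := by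
  by_contra hinf
  let e := Set.Infinite.natEmbedding _ hinf
  choose μ z w h hp using fun n => (e n).2
  let l : Filter ℕ := hyperfilter ℕ
  let K := Germ l ℂ
  let : Field K := Germ.instField
  -- `K` is the ultrapower of `ℂ`, and `π` sends a sequence to its class in `K`.
  let π : (ℕ → ℂ) →+* K := Germ.coeRingHom l
  have hπ : ∀ u v : ℕ → ℂ, π u = π v ↔ ∀ᶠ n in l, u n = v n := fun u v => Germ.coe_eq
  have hinv : ∀ u : ℕ → ℂ, π u⁻¹ = (π u)⁻¹ := fun u => rfl
  let : Algebra ℂ K := (π.comp (Pi.constRingHom ℕ ℂ)).toAlgebra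
  have hinj : ∀ u : ℕ → Fin N → ℂ, (∀ n, Function.Injective (u n)) →
      Function.Injective fun i => π fun n => u n i := by
    intro u hu i j hij
    obtain ⟨n, hn⟩ := ((hπ _ _).1 hij).exists
    exact hu n hn
  have hsum : ∀ (m : ℕ → ℂ) (u v : ℕ → Fin N → ℂ), (∀ n i, m n * v n i = ∑ j, (u n i - u n j)⁻¹) →
      ∀ i, π m * π (fun n => v n i) = ∑ j, (π (fun n => u n i) - π fun n => u n j)⁻¹ := by
    intro m u v hm i
    simp only [← map_sub, ← hinv, ← map_sum, ← map_mul]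
    congr 1
    funext n
    simpa using hm n i
  have hK : IsCentralConfig (algebraMap ℂ K r) (π μ) (fun i => π fun n => z n i)
      fun i => π fun n => w n i :=
    { injective_left := hinj z fun n => (h n).injective_left
      injective_right := hinj w fun n => (h n).injective_right
      eq_left := hsum μ z w fun n => (h n).eq_left
      eq_right := hsum μ w z fun n => (h n).eq_right
      sum_mul := by
        simp only [← map_mul, ← map_sum]
        change _ = π fun _ => r
        congr 1
        funext n
        simpa using (h n).sum_mul }
  obtain ⟨a, ha⟩ := hK.exists_algebraMap_eq_pairProd
  have ha' : π (fun _ => a) = π fun n => (e n : ℂ) := by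
    change algebraMap ℂ K a = _
    rw [ha]
    simp only [← hp]
    simp only [pairProd, ← map_sub, ← map_mul, ← map_prod]
    congr 1
    funext n
    simp
  -- The values `e n` are distinct, so at most one of them is `a`.
  have hfin : {n | a = (e n : ℂ)}.Finite := by
    refine Set.Subsingleton.finite fun m hm n hn => ?_
    exact e.injective (Subtype.ext ((Eq.symm hm).trans hn))
  exact hfin.notMem_hyperfilter ((hπ _ _).1 ha')

/-! ### Relative equilibria of identical vortices -/

theorem symJ_eq (w : ℂ) : symJ w = -Complex.I * w := by
  apply Complex.ext <;> simp [symJ]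

/-- `∇ log |z|² = 2 / conj z`. -/
theorem hasGradientAt_log_norm_sq {z : ℂ} (hz : z ≠ 0) :
    HasGradientAt (fun w : ℂ => Real.log (‖w‖ ^ 2)) (2 * (starRingEnd ℂ z)⁻¹) z := by
  have hz' : ‖z‖ ^ 2 ≠ 0 := by simpa using hz
  rw [hasGradientAt_iff_hasFDerivAt]
  refine (((hasStrictFDerivAt_norm_sq z).hasFDerivAt).log hz').congr_fderiv ?_
  ext v
  simp [Complex.inv_re, Complex.inner, Complex.normSq_eq_norm_sq]
  ring

/-- The gradient of `log |z_a - z_b|²` in the position of the `i`-th vortex. -/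
theorem hasGradientAt_log_norm_sub_sq {N : ℕ} {z : Config N} (i : Fin N) {a b : Fin N}
    (hab : z a ≠ z b) :
    HasGradientAt
      (fun w : ℂ => Real.log (‖Function.update z i w a - Function.update z i w b‖ ^ 2))
      (2 * ((starRingEnd ℂ (z a - z b))⁻¹ *
          ((Pi.single i 1 : Fin N → ℂ) a - (Pi.single i 1 : Fin N → ℂ) b))) (z i) := by
  have hne : a ≠ b := fun h => hab (congrArg z h)
  have hz : z a - z b ≠ 0 := sub_ne_zero.2 hab
  rw [hasGradientAt_iff_hasFDerivAt]
  have hcoord : ∀ d : Fin N, HasFDerivAt (𝕜 := ℝ) (fun w : ℂ => Function.update z i w d)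
      ((Pi.single i 1 : Fin N → ℝ) d • ContinuousLinearMap.id ℝ ℂ) (z i) := by
    intro d
    by_cases hd : d = i
    · subst hd
      simp only [Function.update_self, Pi.single_eq_same, one_smul]
      exact hasFDerivAt_id (𝕜 := ℝ) (z d)
    · simp only [Function.update_of_ne hd, Pi.single_eq_of_ne hd]
      exact (hasFDerivAt_const (𝕜 := ℝ) (z d) (z i)).congr_fderiv (zero_smul ℝ _).symm
  have hlog := (hasGradientAt_log_norm_sq hz).hasFDerivAt
  have heq : Function.update z i (z i) a - Function.update z i (z i) b = z a - z b := by simp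
  rw [← heq] at hlog
  refine (hlog.comp (z i) ((hcoord a).sub (hcoord b))).congr_fderiv ?_
  rw [heq]
  have hcast : ∀ d, (Pi.single i 1 : Fin N → ℂ) d = ((Pi.single i 1 : Fin N → ℝ) d : ℝ) :=
    fun d => by
    by_cases hd : d = i
    · subst hd; simp
    · simp [Pi.single_eq_of_ne hd]
  rw [hcast, hcast]
  ext v
  simp [Complex.inner]
  ring

/-- For identical vortices, `∇_{z_i} H = -(c² / 2π) ∑_j 1 / conj (z_i - z_j)`. -/
theorem gradH_const {N : ℕ} (c : ℝ) {z : Config N} (hz : Function.Injective z) (i : Fin N) :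
    gradH (fun _ => c) z i =
      ((-(c ^ 2 / (2 * Real.pi)) : ℝ) : ℂ) * ∑ j, (starRingEnd ℂ (z i - z j))⁻¹ := by
  have hsum : HasGradientAt (fun w : ℂ => hamiltonian (fun _ => c) (Function.update z i w))
      ((-(1 / (4 * Real.pi)) : ℝ) • ∑ a, ∑ b ∈ Finset.Ioi a, (c * c) •
        (2 * ((starRingEnd ℂ (z a - z b))⁻¹ *
          ((Pi.single i 1 : Fin N → ℂ) a - (Pi.single i 1 : Fin N → ℂ) b)))) (z i) := by
    rw [hasGradientAt_iff_hasFDerivAt]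
    simp only [map_smul, map_sum, hamiltonian]
    refine HasFDerivAt.const_mul (HasFDerivAt.fun_sum fun a _ => HasFDerivAt.fun_sum fun b hb =>
      HasFDerivAt.const_mul ?_ (c * c)) _
    exact (hasGradientAt_log_norm_sub_sq i
      (hz.ne (Finset.mem_Ioi.1 hb).ne)).hasFDerivAt
  have hpair := sum_Ioi_smul_sub (fun a b => (starRingEnd ℂ (z a - z b))⁻¹)
    (Pi.single i (1 : ℂ)) (by simp) fun a b => by rw [← neg_sub, map_neg, inv_neg]
  simp only [smul_eq_mul] at hpair
  rw [gradH, hsum.gradient]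
  simp only [← Finset.smul_sum, ← Finset.mul_sum, hpair]
  simp only [← Finset.sum_mul]
  rw [Finset.sum_eq_single i (fun b _ hb => by simp [Pi.single_eq_of_ne hb]) (by simp)]
  simp only [Pi.single_eq_same, mul_one, Complex.real_smul]
  push_cast
  ring

/-- The velocity of a rigidly rotating point. -/
theorem hasDerivAt_rotJ (ω : ℝ) (w : ℂ) (t : ℝ) :
    HasDerivAt (fun s : ℝ => rotJ (ω * s) w) (ω • symJ (rotJ (ω * t) w)) t := by
  have hlin : HasDerivAt (fun s : ℝ => ω * s) ω t := by
    simpa using (hasDerivAt_id t).const_mul ω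
  refine (((hlin.cos).smul_const w).add ((hlin.sin).smul_const (symJ w))).congr_deriv ?_
  simp only [rotJ, symJ_eq, Complex.real_smul]
  push_cast
  linear_combination (-ω * Complex.sin (ω * t) * w) * Complex.I_sq

/-- A normalised relative equilibrium of identical vortices gives, at each time, a central
configuration `(z, conj z)`. -/
theorem exists_isCentralConfig {N : ℕ} {c : ℝ} (hc : c ≠ 0) {z : ℝ → Config N}
    (hz : z ∈ Z1 (N := N) fun _ => c) (t : ℝ) :
    ∃ μ : ℂ, IsCentralConfig ((c⁻¹ : ℝ) : ℂ) μ (z t) fun i => starRingEnd ℂ (z t i) := by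
  obtain ⟨⟨⟨hinj, hode⟩, -, -, ω, hω⟩, hcen, hI⟩ := hz
  have hcentre : vorticityCentre (fun _ => c) (z 0) = 0 := by
    rw [vorticityCentre, hcen 0, smul_zero]
  simp only [hcentre, sub_zero, add_zero] at hω
  -- The equations of motion of `z i = rotJ (ω t) (z 0 i)` say `c ω z_i = ∇_{z_i} H`.
  have hc' : (c : ℂ) ≠ 0 := Complex.ofReal_ne_zero.2 hc
  have hpi : (Real.pi : ℂ) ≠ 0 := Complex.ofReal_ne_zero.2 Real.pi_ne_zero
  have hmain : ∀ i, ((-(2 * Real.pi * ω / c) : ℝ) : ℂ) * z t i =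
      ∑ j, (starRingEnd ℂ (z t i - z t j))⁻¹ := by
    intro i
    obtain ⟨v, hv, hveq⟩ := hode t i
    have hv' : HasDerivAt (fun s => z s i) (ω • symJ (z t i)) t := by
      rw [hω t i]
      exact (hasDerivAt_rotJ ω (z 0 i) t).congr_of_eventuallyEq
        (Filter.Eventually.of_forall fun s => hω s i)
    rw [hv.unique hv', gradH_const c (hinj t), symJ_eq, symJ_eq, Complex.real_smul,
      Complex.real_smul] at hveq
    have h1 : (c : ℂ) * (ω * z t i) = ((-(c ^ 2 / (2 * Real.pi)) : ℝ) : ℂ) *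
        ∑ j, (starRingEnd ℂ (z t i - z t j))⁻¹ :=
      mul_left_cancel₀ (neg_ne_zero.2 Complex.I_ne_zero) (by linear_combination hveq)
    push_cast at h1 ⊢
    field_simp at h1 ⊢
    linear_combination -h1
  refine ⟨((-(2 * Real.pi * ω / c) : ℝ) : ℂ), hinj t, (starRingEnd ℂ).injective.comp (hinj t),
    fun i => ?_, fun i => ?_, ?_⟩
  · simpa [-Complex.ofReal_neg, -Complex.ofReal_div, -Complex.ofReal_mul] using
      congrArg (starRingEnd ℂ) (hmain i)
  · simpa only [map_sub] using hmain i
  · have h2 : c * ∑ i, ‖z t i‖ ^ 2 = 1 := by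
      rw [Finset.mul_sum]
      exact hI t
    rw [← eq_inv_of_mul_eq_one_right h2]
    push_cast
    exact Finset.sum_congr rfl fun i _ => Complex.mul_conj' (z t i)

theorem pairProd_conj {N : ℕ} (z : Config N) :
    pairProd z (fun i => starRingEnd ℂ (z i)) =
      ((∏ i, ∏ j ∈ Finset.Ioi i, ‖z i - z j‖ ^ 2 : ℝ) : ℂ) := by
  push_cast
  refine Finset.prod_congr rfl fun i _ => Finset.prod_congr rfl fun j _ => ?_
  rw [← map_sub, Complex.mul_conj']

/-- For identical vortices the Hamiltonian is a function of the pair product. -/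
theorem hamiltonian_const {N : ℕ} (c : ℝ) {z : Config N} (hz : Function.Injective z) :
    hamiltonian (fun _ => c) z = -(1 / (4 * Real.pi)) *
      (c * c * Real.log (pairProd z fun i => starRingEnd ℂ (z i)).re) := by
  have hne : ∀ i, ∀ j ∈ Finset.Ioi i, ‖z i - z j‖ ^ 2 ≠ 0 := fun i j hj =>
    pow_ne_zero 2 (norm_ne_zero_iff.2 (sub_ne_zero.2 (hz.ne (Finset.mem_Ioi.1 hj).ne)))
  rw [pairProd_conj, Complex.ofReal_re,
    Real.log_prod fun i _ => Finset.prod_ne_zero_iff.2 (hne i), hamiltonian]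
  congr 1
  rw [Finset.mul_sum]
  refine Finset.sum_congr rfl fun i _ => ?_
  rw [Real.log_prod (hne i), Finset.mul_sum]

end NVortex

theorem mainTheorem8 (N : ℕ) (Γ : Fin N → ℝ) (c : ℝ) (hc : c ≠ 0) (hΓ : ∀ i, Γ i = c) :
    (NVortex.H1 Γ).Finite := by
  obtain rfl : Γ = fun _ => c := funext hΓ
  refine ((NVortex.finite_pairProd N ((c⁻¹ : ℝ) : ℂ)).image fun p : ℂ =>
    -(1 / (4 * Real.pi)) * (c * c * Real.log p.re)).subset ?_
  rintro _ ⟨z, hz, t, rfl⟩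
  obtain ⟨μ, hμ⟩ := NVortex.exists_isCentralConfig hc hz t
  exact ⟨_, ⟨μ, _, _, hμ, rfl⟩, (NVortex.hamiltonian_const c hμ.injective_left).symm⟩
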